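/- Let $d\ge 0$ and let $D\subset\mathbb{R}^d$ be a finite set that is not contained in a hyperplane (i.e. its affine hull is $\mathbb{R}^d$); put $\Omega=\operatorname{conv}(D)$. Let $n\ge 1$ and let $(\bar x_i,\bar y_i)\in\mathbb{R}^d\times\mathbb{R}^d$, $i=1,\dots,n$, be given samples. *Spaces.* $\mathrm{Lip}(\mathbb{R}^d)$ is the Banach space of Lipschitz maps $T:\mathbb{R}^d\to\mathbb{R}^d$ with norm $\|T(0)\|+\sup_{x\ne y}\|T(x)-T(y)\|/\|x-y\|$. It is a dual space, its canonical predual ($\mathbb{R}^d$ times the $\mathbb{R}^d$-valued Arens--Eells space) being the norm-closed linear span, in the dual of $\mathrm{Lip}(\mathbb{R}^d)$, of the functionals $T\mapsto\langle v,T(x)\rangle$, $x,v\in\mathbb{R}^d$; weak* convergence $\stackrel{*}{\rightharpoonup}$ is with respect to this predual. Let $\mathcal N\subset\mathrm{Lip}(\mathbb{R}^d)$ be the set of nonexpansive operators, $\|N(x)-N(y)\|\le\|x-y\|$ for all $x,y$, and $$\widehat F(N)=\frac1n\sum_{i=1}^n\|N(\bar x_i)-\bar y_i\|^2 .$$ *Partitions.*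 A simplicial partition of $\Omega$ is a finite set $\mathfrak T$ of simplices, each the convex hull of $d+1$ distinct points (its vertices) and with non-empty interior, such that $\sum_{S\in\mathfrak T}\chi_S=\chi_\Omega$ Lebesgue-a.e. and the intersection of any two simplices is the convex hull of their common vertices (empty if there are none). If $x_1,\dots,x_m$ are the vertices of all simplices of $\mathfrak T$, let $\lambda_1,\dots,\lambda_m$ be the associated Lagrange elements of order one: functions on $\Omega$ with $\lambda_i(x_j)=\delta_{ij}$ that are affine on each simplex. Let $\pi_\Omega$ be the metric projection onto $\Omega$ and $$\mathrm{PA}(\mathfrak T)=\Bigl\{\Bigl(\sum_{i=1}^m\lambda_i\,y_i\Bigr)\circ\pi_\Omega \;:\; y_1,\dots,y_m\in\mathbb{R}^d\Bigr\}.$$ *Families.* Let $(\mathfrak T_k)_{k\ge1}$ be simplicial partitions of $\Omega$ that form a strongly regular vanishing family: for every $k\ge1$ all edges of simplices in $\mathfrak T_k$ have length at most $1/k$, and there is $c>0$ such that every simplex $S\in\mathfrak T_k$, for every $k\ge 1$, has Lebesgue measure at least $c\,k^{-d}$. Assume moreover that every $\bar x_i$ is a vertex of $\mathfrak T_k$,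 for every $k\ge 1$. **Theorem.** For every sequence of operators $$\widehat L_k\in\operatorname*{arg\,min}_{N\in \mathrm{PA}(\mathfrak T_k)\cap\mathcal N}\widehat F(N),\qquad k\ge1,$$ there exist a subsequence $(\widehat L_{k_j})_{j\in\mathbb N}$ and an operator $\widehat L\in\operatorname*{arg\,min}_{N\in\mathcal N}\widehat F(N)$ such that $\widehat L_{k_j}\stackrel{*}{\rightharpoonup}\widehat L$ in $\mathrm{Lip}(\mathbb{R}^d)$ as $j\to\infty$. -/

import Mathlib

open Filter Topology MeasureTheory Set

namespace NonexpansiveLearning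

/-! ### The Banach space `Lip(E)` of Lipschitz operators on a real Hilbert space `E` -/

section LipschitzOperators

variable (E : Type*) [NormedAddCommGroup E] [InnerProductSpace ℝ E]

/-- The Lipschitz maps `E → E`, as a linear subspace of all maps. -/
def lipSubmodule : Submodule ℝ (E → E) where
  carrier := {f | ∃ K, LipschitzWith K f}
  zero_mem' := ⟨0, LipschitzWith.const (0 : E)⟩
  add_mem' := by
    rintro f g ⟨K, hK⟩ ⟨K', hK'⟩
    exact ⟨K + K', hK.add hK'⟩
  smul_mem' := by
    rintro c f ⟨K, hK⟩
    exact ⟨‖c‖₊ * K, (lipschitzWith_smul c).comp hK⟩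

/-- `Lip(E)`: the vector space of Lipschitz operators `E → E`. -/
def LipOp : Type _ := ↥(lipSubmodule E)

noncomputable instance : AddCommGroup (LipOp E) :=
  inferInstanceAs (AddCommGroup ↥(lipSubmodule E))

noncomputable instance : Module ℝ (LipOp E) :=
  inferInstanceAs (Module ℝ ↥(lipSubmodule E))

instance : CoeFun (LipOp E) (fun _ => E → E) := ⟨fun T => T.1⟩

variable {E}

/-- The quantity `𝓛(T) = sup_{x ≠ y} ‖T x - T y‖ / ‖x - y‖`, the smallest Lipschitz constant
of `T` (pairs with `x = y` contribute the value `0` and are harmless). -/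
noncomputable def lipConst (T : LipOp E) : ℝ :=
  ⨆ p : E × E, ‖T p.1 - T p.2‖ / ‖p.1 - p.2‖

/-- The norm `‖T‖_Lip = ‖T 0‖ + 𝓛(T - T 0) = ‖T 0‖ + 𝓛(T)`. -/
noncomputable instance : Norm (LipOp E) := ⟨fun T => ‖T 0‖ + lipConst T⟩

theorem lipOp_norm_def (T : LipOp E) : ‖T‖ = ‖T 0‖ + lipConst T := rfl

theorem lipOp_ext {T S : LipOp E} (h : ∀ x, T x = S x) : T = S := Subtype.ext (funext h)

theorem lipOp_add_apply (T S : LipOp E) (x : E) : (T + S) x = T x + S x := rfl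

theorem lipOp_smul_apply (c : ℝ) (T : LipOp E) (x : E) : (c • T) x = c • T x := rfl

theorem lipOp_zero_apply (x : E) : (0 : LipOp E) x = 0 := rfl

theorem lipConst_bddAbove (T : LipOp E) :
    BddAbove (range fun p : E × E => ‖T p.1 - T p.2‖ / ‖p.1 - p.2‖) := by
  obtain ⟨K, hK⟩ := T.2
  refine ⟨K, ?_⟩
  rintro _ ⟨p, rfl⟩
  refine div_le_of_le_mul₀ (norm_nonneg _) K.2 ?_
  have := hK.dist_le_mul p.1 p.2
  rwa [dist_eq_norm, dist_eq_norm] at this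

theorem lipConst_nonneg (T : LipOp E) : 0 ≤ lipConst T :=
  Real.iSup_nonneg fun _ => div_nonneg (norm_nonneg _) (norm_nonneg _)

theorem norm_sub_le_lipConst (T : LipOp E) (x y : E) :
    ‖T x - T y‖ ≤ lipConst T * ‖x - y‖ := by
  rcases eq_or_ne x y with rfl | hxy
  · simp
  · rw [← div_le_iff₀ (norm_pos_iff.2 (sub_ne_zero.2 hxy))]
    exact le_ciSup (lipConst_bddAbove T) (x, y)

theorem lipConst_le (T : LipOp E) {C : ℝ} (hC : 0 ≤ C)
    (h : ∀ x y, ‖T x - T y‖ ≤ C * ‖x - y‖) : lipConst T ≤ C :=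
  ciSup_le fun p => div_le_of_le_mul₀ (norm_nonneg _) hC (h p.1 p.2)

theorem lipOp_norm_apply_le (T : LipOp E) (x : E) : ‖T x‖ ≤ ‖T‖ * (1 + ‖x‖) := by
  have h1 : ‖T x - T 0‖ ≤ lipConst T * ‖x‖ := by simpa using norm_sub_le_lipConst T x 0
  have h2 : ‖T x‖ ≤ ‖T x - T 0‖ + ‖T 0‖ := by simpa using norm_add_le (T x - T 0) (T 0)
  have h3 := lipConst_nonneg T
  have h4 := mul_nonneg (norm_nonneg (T 0)) (norm_nonneg x)
  rw [lipOp_norm_def]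
  linarith

theorem lipOp_normCore : NormedSpace.Core ℝ (LipOp E) where
  norm_nonneg T := add_nonneg (norm_nonneg _) (lipConst_nonneg T)
  norm_smul c T := by
    have hle : ∀ (c : ℝ) (T : LipOp E), lipConst (c • T) ≤ ‖c‖ * lipConst T := by
      intro c T
      refine lipConst_le _ (mul_nonneg (norm_nonneg _) (lipConst_nonneg T)) fun x y => ?_
      rw [lipOp_smul_apply, lipOp_smul_apply, ← smul_sub, norm_smul, mul_assoc]
      exact mul_le_mul_of_nonneg_left (norm_sub_le_lipConst T x y) (norm_nonneg _)
    have heq : lipConst (c • T) = ‖c‖ * lipConst T := by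
      refine le_antisymm (hle c T) ?_
      rcases eq_or_ne c 0 with rfl | hc
      · simpa using lipConst_nonneg _
      · have := hle c⁻¹ (c • T)
        rw [smul_smul, inv_mul_cancel₀ hc, one_smul, norm_inv] at this
        rwa [← div_eq_inv_mul, le_div_iff₀ (norm_pos_iff.2 hc), mul_comm] at this
    rw [lipOp_norm_def, lipOp_norm_def, heq, lipOp_smul_apply, norm_smul, mul_add]
  norm_triangle T S := by
    have : lipConst (T + S) ≤ lipConst T + lipConst S := by
      refine lipConst_le _ (add_nonneg (lipConst_nonneg T) (lipConst_nonneg S)) fun x y => ?_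
      rw [lipOp_add_apply, lipOp_add_apply, add_sub_add_comm, add_mul]
      exact (norm_add_le _ _).trans
        (add_le_add (norm_sub_le_lipConst T x y) (norm_sub_le_lipConst S x y))
    have h0 : ‖(T + S) 0‖ ≤ ‖T 0‖ + ‖S 0‖ := norm_add_le _ _
    rw [lipOp_norm_def, lipOp_norm_def, lipOp_norm_def]
    linarith
  norm_eq_zero_iff T := by
    constructor
    · intro h
      refine lipOp_ext fun x => ?_
      have := lipOp_norm_apply_le T x
      rw [h, zero_mul] at this
      exact norm_le_zero_iff.1 this
    · rintro rfl
      rw [lipOp_norm_def]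
      have : lipConst (0 : LipOp E) ≤ 0 :=
        lipConst_le _ le_rfl fun x y => by simp [lipOp_zero_apply]
      simp [lipOp_zero_apply, le_antisymm this (lipConst_nonneg _)]

noncomputable instance : NormedAddCommGroup (LipOp E) := NormedAddCommGroup.ofCore lipOp_normCore

noncomputable instance : NormedSpace ℝ (LipOp E) := NormedSpace.ofCore lipOp_normCore

/-- The bounded linear functional `T ↦ ⟪v, T x⟫` on `Lip(E)`. -/
noncomputable def evalFunctional (x v : E) : StrongDual ℝ (LipOp E) :=
  LinearMap.mkContinuous
    { toFun := fun T => inner ℝ v (T x)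
      map_add' := fun T S => by rw [lipOp_add_apply, inner_add_right]
      map_smul' := fun c T => by
        rw [lipOp_smul_apply, inner_smul_right, RingHom.id_apply, smul_eq_mul] }
    (‖v‖ * (1 + ‖x‖))
    (fun T => by
      refine (norm_inner_le_norm v (T x)).trans ?_
      calc ‖v‖ * ‖T x‖ ≤ ‖v‖ * (‖T‖ * (1 + ‖x‖)) :=
            mul_le_mul_of_nonneg_left (lipOp_norm_apply_le T x) (norm_nonneg _)
        _ = ‖v‖ * (1 + ‖x‖) * ‖T‖ := by ring)

variable (E)

/-- The canonical predual `E × Æ(E)` of `Lip(E)`, `Æ(E)` being the (`E`-valued) Arens–Eells space,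
also called Lipschitz-free space. It is realized in the usual way inside the dual of `Lip(E)`:
it is the norm-closed linear span of the evaluation functionals `T ↦ ⟪v, T x⟫`
(`x = 0` gives the factor `E`; the differences `T ↦ ⟪v, T x - T y⟫`, that is, the
elementary molecules, span the factor `Æ(E)`). -/
noncomputable def lipPredual : Submodule ℝ (StrongDual ℝ (LipOp E)) :=
  (Submodule.span ℝ (range fun p : E × E => evalFunctional p.1 p.2)).topologicalClosure

variable {E}

/-- Weak* convergence of a sequence in `Lip(E)`: convergence against every element
of the predual. -/
def WeakStarTendsto (T : ℕ → LipOp E) (S : LipOp E) : Prop :=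
  ∀ p ∈ lipPredual E, Tendsto (fun j => p (T j)) atTop (𝓝 (p S))

variable (E)

/-- The set `𝒩` of nonexpansive operators, as a subset of `Lip(E)`. -/
def nonexpansiveOps : Set (LipOp E) := {N | ∀ x y, ‖N x - N y‖ ≤ ‖x - y‖}

variable {E}

/-- The discrete least-squares risk `(1/n) ∑ i, ‖N(x̄ i) - ȳ i‖²` of the samples `(x̄ i, ȳ i)`. -/
noncomputable def discreteRisk {n : ℕ} (xbar ybar : Fin n → E) (N : LipOp E) : ℝ :=
  (1 / (n : ℝ)) * ∑ i, ‖N (xbar i) - ybar i‖ ^ 2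

end LipschitzOperators

/-- The set of minimizers of `F` over `A`. -/
def argminOn {α : Type*} (F : α → ℝ) (A : Set α) : Set α := {a | a ∈ A ∧ ∀ b ∈ A, F a ≤ F b}

/-! ### Simplicial partitions and piecewise affine operators -/

section Partitions

variable {d : ℕ}

/-- `𝔗` is a (face-to-face) simplicial partition of `Ω ⊆ ℝ^d`. A simplex is given by the finite set
`s` of its `d + 1` distinct vertices; as a set it is the convex hull of `s`. -/
structure IsSimplicialPartition (Ω : Set (EuclideanSpace ℝ (Fin d)))
    (𝔗 : Finset (Finset (EuclideanSpace ℝ (Fin d)))) : Prop where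
  /-- Every simplex is spanned by `d + 1` distinct points. -/
  card_eq : ∀ s ∈ 𝔗, s.card = d + 1
  /-- The simplices partition `Ω` up to Lebesgue null sets. -/
  sum_indicator : ∀ᵐ x ∂(volume : Measure (EuclideanSpace ℝ (Fin d))),
    ∑ s ∈ 𝔗, (convexHull ℝ (s : Set (EuclideanSpace ℝ (Fin d)))).indicator (fun _ => (1 : ℝ)) x
      = Ω.indicator (fun _ => (1 : ℝ)) x
  /-- Every simplex has non-empty interior. -/
  interior_nonempty : ∀ s ∈ 𝔗,
    (interior (convexHull ℝ (s : Set (EuclideanSpace ℝ (Fin d))))).Nonempty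
  /-- Two simplices meet in the convex hull of their common vertices
  (in particular they are disjoint if there are none). -/
  inter_eq : ∀ s ∈ 𝔗, ∀ t ∈ 𝔗,
    convexHull ℝ (s : Set (EuclideanSpace ℝ (Fin d))) ∩
        convexHull ℝ (t : Set (EuclideanSpace ℝ (Fin d)))
      = convexHull ℝ ((s : Set (EuclideanSpace ℝ (Fin d))) ∩ t)

open Classical in
/-- The vertices of all the simplices of `𝔗`. -/
noncomputable def vertices (𝔗 : Finset (Finset (EuclideanSpace ℝ (Fin d)))) :
    Finset (EuclideanSpace ℝ (Fin d)) :=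
  𝔗.biUnion id

open Classical in
/-- `lam v`, for `v` a vertex of `𝔗`, are the Lagrange elements of order one: `lam v w = δ_{vw}` at
the vertices, and each `lam v` is affine on each simplex. -/
def IsLagrangeBasis (𝔗 : Finset (Finset (EuclideanSpace ℝ (Fin d))))
    (lam : EuclideanSpace ℝ (Fin d) → EuclideanSpace ℝ (Fin d) → ℝ) : Prop :=
  (∀ v ∈ vertices 𝔗, ∀ w ∈ vertices 𝔗, lam v w = if v = w then 1 else 0) ∧
  ∀ v ∈ vertices 𝔗, ∀ s ∈ 𝔗, ∃ g : EuclideanSpace ℝ (Fin d) →ᵃ[ℝ] ℝ,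
    EqOn (lam v) g (convexHull ℝ (s : Set (EuclideanSpace ℝ (Fin d))))

open Classical in
/-- The projection onto `Ω`: the nearest point of `Ω` (unique if `Ω` is non-empty, closed
and convex). -/
noncomputable def proj (Ω : Set (EuclideanSpace ℝ (Fin d))) (x : EuclideanSpace ℝ (Fin d)) :
    EuclideanSpace ℝ (Fin d) :=
  if h : ∃ p ∈ Ω, ∀ q ∈ Ω, ‖x - p‖ ≤ ‖x - q‖ then h.choose else x

/-- `PA(𝔗)`: the piecewise affine operators on `Ω` associated with the simplicial partition `𝔗`
of `Ω`, extended to the whole space through the projection onto `Ω`; that is, the operators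
`Ñ ∘ π_Ω` with `Ñ = ∑ v, λ_v • y_v` for arbitrary values `y_v` at the vertices. -/
def piecewiseAffineOps (Ω : Set (EuclideanSpace ℝ (Fin d)))
    (𝔗 : Finset (Finset (EuclideanSpace ℝ (Fin d)))) :
    Set (LipOp (EuclideanSpace ℝ (Fin d))) :=
  {N | ∃ lam, IsLagrangeBasis 𝔗 lam ∧
    ∃ y : EuclideanSpace ℝ (Fin d) → EuclideanSpace ℝ (Fin d),
      ∀ x, N x = ∑ v ∈ vertices 𝔗, lam v (proj Ω x) • y v}

/-- A vanishing family of simplicial partitions of `Ω`: the edges of the `k`-th partition,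
`k = 1, 2, …`, have length at most `1 / k`. -/
def IsVanishingFamily (Ω : Set (EuclideanSpace ℝ (Fin d)))
    (𝔉 : ℕ+ → Finset (Finset (EuclideanSpace ℝ (Fin d)))) : Prop :=
  (∀ k, IsSimplicialPartition Ω (𝔉 k)) ∧
  ∀ k, ∀ s ∈ 𝔉 k, ∀ v ∈ s, ∀ w ∈ s, dist v w ≤ 1 / (k : ℝ)

/-- Strong regularity: there is `c > 0` such that all simplices of the `k`-th partition have
Lebesgue measure at least `c k^{-d}`, for all `k`. -/
def IsStronglyRegular (𝔉 : ℕ+ → Finset (Finset (EuclideanSpace ℝ (Fin d)))) : Prop :=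
  ∃ c : ℝ, 0 < c ∧ ∀ k, ∀ s ∈ 𝔉 k,
    c / (k : ℝ) ^ d ≤
      (volume : Measure (EuclideanSpace ℝ (Fin d))).real
        (convexHull ℝ (s : Set (EuclideanSpace ℝ (Fin d))))

end Partitions

end NonexpansiveLearning

open NonexpansiveLearning

/-!
The operators `L k` are nonexpansive, and comparison with the zero operator bounds their risk, hence
their values at a sample point and so at every point. A subsequence therefore converges pointwise to
a nonexpansive operator (Tychonoff on a dense sequence, equicontinuity elsewhere), and on
norm-bounded sequences pointwise convergence is weak* convergence
(`exists_subseq_weakStarTendsto`).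

The limit is a minimizer because piecewise affine nonexpansive operators are rich enough. Every
nonexpansive `N` is a pointwise limit of `C¹` maps `M` that are `q`-Lipschitz with `q < 1`
(`exists_seq_contDiff_contraction_tendsto`: shrunken mollifications). For a fixed such `M` and large
`k`, the piecewise affine interpolant of `M` on the `k`-th partition is itself nonexpansive
(`eventually_exists_mem_piecewiseAffineOps`). Indeed, on a simplex with vertex `v₀` the linear part
of the interpolant and `fderiv ℝ M v₀` differ on each edge at `v₀` by at most the mesh size `1 / k`
times the oscillation of the derivative. Strong regularity bounds the determinant of the edges below
by `c k⁻ᵈ`, so by Cramer's rule every unit vector is a combination of edges with coefficients at most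
`(d! / c) k` (`norm_le_of_norm_apply_edge_le`), and the operator norm of that difference tends
to `0`. Being `1`-Lipschitz on each simplex of a finite closed cover of a convex set, the
interpolant is `1`-Lipschitz on the set (`norm_sub_le_of_finite_closed_cover`), and the metric
projection extends it to the whole space. The sample points are vertices, so the interpolant has the
same risk as `M`; thus the risk of `L k` is eventually at most that of `M`, and the limit `M → N`
gives minimality.
-/

/-! ### Weak* compactness of pointwise bounded sequences of nonexpansive operators -/

section Compactness

variable {E : Type*} [NormedAddCommGroup E] [InnerProductSpace ℝ E]

theorem lipOp_norm_le_of_mem_nonexpansiveOps {T : LipOp E} (hT : T ∈ nonexpansiveOps E) :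
    ‖T‖ ≤ ‖T 0‖ + 1 := by
  rw [lipOp_norm_def]
  gcongr
  exact lipConst_le T zero_le_one fun x y => by simpa using hT x y

/-- On norm-bounded sequences, pointwise convergence implies weak* convergence: the functionals
along which the sequence converges form a closed subspace containing the evaluations. -/
theorem weakStarTendsto_of_tendsto_apply {T : ℕ → LipOp E} {S : LipOp E} {C : ℝ}
    (hT : ∀ j, ‖T j‖ ≤ C) (h : ∀ x, Tendsto (fun j => T j x) atTop (𝓝 (S x))) :
    WeakStarTendsto T S := by
  intro p hp
  have hspan : ∀ q ∈ Submodule.span ℝ (range fun p : E × E => evalFunctional p.1 p.2),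
      Tendsto (fun j => q (T j)) atTop (𝓝 (q S)) := by
    intro q hq
    induction hq using Submodule.span_induction with
    | mem q hq =>
      obtain ⟨⟨x, v⟩, rfl⟩ := hq
      exact Tendsto.inner tendsto_const_nhds (h x)
    | zero => simp
    | add q r _ _ hq hr => simpa using hq.add hr
    | smul c q _ hq => simpa using hq.const_mul c
  rw [Metric.tendsto_atTop]
  intro ε hε
  have hC : 0 ≤ C := (norm_nonneg _).trans (hT 0)
  have hM : 0 < C + ‖S‖ + 1 := by positivity
  obtain ⟨q, hq, hpq⟩ := Metric.mem_closure_iff.1 hp (ε / 2 / (C + ‖S‖ + 1)) (by positivity)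
  obtain ⟨J, hJ⟩ := Metric.tendsto_atTop.1 (hspan q hq) (ε / 2) (half_pos hε)
  refine ⟨J, fun j hj => ?_⟩
  have h1 := hJ j hj
  rw [Real.dist_eq] at h1 ⊢
  rw [dist_eq_norm, lt_div_iff₀ hM] at hpq
  have h2 : |(p - q) (T j - S)| ≤ ‖p - q‖ * (C + ‖S‖ + 1) := by
    refine ((p - q).le_opNorm _).trans ?_
    gcongr
    linarith [norm_sub_le (T j) S, hT j]
  have h3 : p (T j) - p S = (p - q) (T j - S) + (q (T j) - q S) := by
    simp only [sub_apply, map_sub]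
    ring
  rw [h3]
  linarith [abs_add_le ((p - q) (T j - S)) (q (T j) - q S)]

/-- A pointwise bounded sequence of nonexpansive operators on a finite-dimensional space has a
subsequence converging weak* and pointwise to a nonexpansive operator: Tychonoff's theorem on a
dense sequence of points, and equicontinuity at the remaining points. -/
theorem exists_subseq_weakStarTendsto [FiniteDimensional ℝ E] {T : ℕ → LipOp E}
    (hT : ∀ j, T j ∈ nonexpansiveOps E) {R : E → ℝ} (hR : ∀ j x, ‖T j x‖ ≤ R x) :
    ∃ φ : ℕ → ℕ, StrictMono φ ∧ ∃ S ∈ nonexpansiveOps E,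
      (∀ x, Tendsto (fun j => T (φ j) x) atTop (𝓝 (S x))) ∧
      WeakStarTendsto (fun j => T (φ j)) S := by
  have : ProperSpace E := FiniteDimensional.proper ℝ E
  set u := TopologicalSpace.denseSeq E with hu
  have hcomp : IsCompact (Set.pi univ fun m => Metric.closedBall (0 : E) (R (u m))) :=
    isCompact_univ_pi fun m => isCompact_closedBall _ _
  obtain ⟨a, -, φ, hφ, hlim⟩ := hcomp.tendsto_subseq (x := fun j m => T j (u m))
    fun j m _ => by simpa using hR j (u m)
  have hlim' : ∀ m, Tendsto (fun j => T (φ j) (u m)) atTop (𝓝 (a m)) := fun m =>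
    (tendsto_pi_nhds.1 hlim) m
  have hcau : ∀ x, ∃ z, Tendsto (fun j => T (φ j) x) atTop (𝓝 z) := by
    intro x
    refine cauchySeq_tendsto_of_complete (Metric.cauchySeq_iff.2 fun ε hε => ?_)
    obtain ⟨m, hm⟩ := (TopologicalSpace.denseRange_denseSeq E).exists_dist_lt x
      (ε := ε / 3) (by positivity)
    obtain ⟨J, hJ⟩ := Metric.cauchySeq_iff.1 (hlim' m).cauchySeq (ε / 3) (by positivity)
    refine ⟨J, fun i hi j hj => ?_⟩
    have h1 := hJ i hi j hj
    have h2 : dist (T (φ i) x) (T (φ i) (u m)) ≤ dist x (u m) := by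
      simpa only [dist_eq_norm] using hT (φ i) x (u m)
    have h3 : dist (T (φ j) (u m)) (T (φ j) x) ≤ dist x (u m) := by
      rw [dist_comm]
      simpa only [dist_eq_norm] using hT (φ j) x (u m)
    have h4 := dist_triangle4 (T (φ i) x) (T (φ i) (u m)) (T (φ j) (u m)) (T (φ j) x)
    rw [← hu] at hm
    linarith
  choose S hS using hcau
  have hSne : ∀ x y, ‖S x - S y‖ ≤ ‖x - y‖ := fun x y =>
    le_of_tendsto ((hS x).sub (hS y)).norm (Eventually.of_forall fun j => hT (φ j) x y)
  refine ⟨φ, hφ, ⟨S, 1, LipschitzWith.of_dist_le_mul fun x y => ?_⟩, hSne, hS, ?_⟩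
  · simpa [dist_eq_norm] using hSne x y
  · refine weakStarTendsto_of_tendsto_apply (C := R 0 + 1) (fun j => ?_) hS
    exact (lipOp_norm_le_of_mem_nonexpansiveOps (hT _)).trans (by gcongr; exact hR _ _)

theorem tendsto_discreteRisk {n : ℕ} (xbar ybar : Fin n → E) {T : ℕ → LipOp E}
    {S : LipOp E} (h : ∀ x, Tendsto (fun j => T j x) atTop (𝓝 (S x))) :
    Tendsto (fun j => discreteRisk xbar ybar (T j)) atTop (𝓝 (discreteRisk xbar ybar S)) :=
  (tendsto_finsetSum _ fun i _ =>
    (((h (xbar i)).sub tendsto_const_nhds).norm.pow 2)).const_mul _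

end Compactness

/-! ### The metric projection onto a convex body -/

section Projection

variable {d : ℕ} {Ω : Set (EuclideanSpace ℝ (Fin d))}

theorem proj_spec (hc : IsClosed Ω) (hne : Ω.Nonempty) (x : EuclideanSpace ℝ (Fin d)) :
    proj Ω x ∈ Ω ∧ ∀ q ∈ Ω, ‖x - proj Ω x‖ ≤ ‖x - q‖ := by
  have h : ∃ p ∈ Ω, ∀ q ∈ Ω, ‖x - p‖ ≤ ‖x - q‖ := by
    obtain ⟨p, hp, hpx⟩ := hc.exists_infDist_eq_dist hne x
    refine ⟨p, hp, fun q hq => ?_⟩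
    rw [← dist_eq_norm, ← dist_eq_norm, ← hpx]
    exact Metric.infDist_le_dist_of_mem hq
  rw [proj, dif_pos h]
  exact h.choose_spec

theorem proj_eq_self (hc : IsClosed Ω) {x : EuclideanSpace ℝ (Fin d)} (hx : x ∈ Ω) :
    proj Ω x = x := by
  have := (proj_spec hc ⟨x, hx⟩ x).2 x hx
  rw [sub_self, norm_zero, norm_le_zero_iff, sub_eq_zero] at this
  exact this.symm

theorem inner_sub_proj_le_zero (hc : IsClosed Ω) (hconv : Convex ℝ Ω)
    (x : EuclideanSpace ℝ (Fin d)) {q : EuclideanSpace ℝ (Fin d)} (hq : q ∈ Ω) :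
    inner ℝ (x - proj Ω x) (q - proj Ω x) ≤ 0 := by
  obtain ⟨hmem, hle⟩ := proj_spec hc ⟨q, hq⟩ x
  have : Nonempty Ω := ⟨⟨q, hq⟩⟩
  refine (norm_eq_iInf_iff_real_inner_le_zero hconv hmem).1 (le_antisymm ?_ ?_) q hq
  · exact le_ciInf fun w => hle w w.2
  · exact ciInf_le ⟨0, by rintro _ ⟨w, rfl⟩; exact norm_nonneg _⟩ (⟨_, hmem⟩ : Ω)

theorem norm_proj_sub_proj_le (hc : IsClosed Ω) (hne : Ω.Nonempty) (hconv : Convex ℝ Ω)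
    (x y : EuclideanSpace ℝ (Fin d)) : ‖proj Ω x - proj Ω y‖ ≤ ‖x - y‖ := by
  have h1 := inner_sub_proj_le_zero hc hconv x (proj_spec hc hne y).1
  have h2 := inner_sub_proj_le_zero hc hconv y (proj_spec hc hne x).1
  set p := proj Ω x
  set q := proj Ω y
  have h3 : inner ℝ (p - q) (p - q) ≤ inner ℝ (x - y) (p - q) := by
    have e : inner ℝ (x - p) (q - p) + inner ℝ (y - q) (p - q)
        = inner ℝ (p - q) (p - q) - inner ℝ (x - y) (p - q) := by
      rw [← neg_sub p q, inner_neg_right, ← sub_eq_neg_add, ← inner_sub_left, ← inner_sub_left]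
      congr 1
      abel
    linarith
  rw [real_inner_self_eq_norm_mul_norm] at h3
  have h4 := real_inner_le_norm (x - y) (p - q)
  by_contra! hlt
  have := mul_lt_mul_of_pos_right hlt ((norm_nonneg _).trans_lt hlt)
  linarith

end Projection

/-! ### Lipschitz functions on finite closed covers -/

section Gluing

variable {E F : Type*} [NormedAddCommGroup E] [NormedSpace ℝ E] [NormedAddCommGroup F]

/-- A function on an interval that is `K`-Lipschitz on each member of a finite closed cover is
`K`-Lipschitz. The induction is on the number of sets: past the last point of a set that contains
the left endpoint, the other sets cover. -/
theorem norm_sub_le_of_finite_closed_cover_Icc {ι : Type*} {f : ℝ → F} {K : ℝ} {C : ι → Set ℝ}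
    (hC : ∀ i, IsClosed (C i)) (hf : ∀ i, ∀ x ∈ C i, ∀ y ∈ C i, ‖f x - f y‖ ≤ K * |x - y|)
    (I : Finset ι) {a b : ℝ} (hab : a ≤ b) (hcov : Icc a b ⊆ ⋃ i ∈ I, C i) :
    ‖f a - f b‖ ≤ K * (b - a) := by
  classical
  induction hI : I.card generalizing I a with
  | zero =>
    rw [Finset.card_eq_zero] at hI
    subst hI
    simpa using hcov (left_mem_Icc.2 hab)
  | succ n ih =>
    obtain ⟨i, hi, hai⟩ : ∃ i ∈ I, a ∈ C i := by simpa using hcov (left_mem_Icc.2 hab)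
    obtain ⟨c, ⟨hcC, hac, hcb⟩, hcmax⟩ :=
      (isCompact_Icc.inter_left (hC i) : IsCompact (C i ∩ Icc a b)).exists_isGreatest
        ⟨a, hai, left_mem_Icc.2 hab⟩
    have h1 : ‖f a - f c‖ ≤ K * (c - a) := by
      have := hf i a hai c hcC
      rwa [abs_sub_comm, abs_of_nonneg (sub_nonneg.2 hac)] at this
    rcases hcb.eq_or_lt with rfl | hlt
    · exact h1
    have hcl : IsClosed (⋃ j ∈ I.erase i, C j) :=
      (I.erase i).finite_toSet.isClosed_biUnion fun j _ => hC j
    have hsub : Ioc c b ⊆ ⋃ j ∈ I.erase i, C j := by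
      intro x hx
      have hxab : x ∈ Icc a b := ⟨hac.trans hx.1.le, hx.2⟩
      obtain ⟨j, hj, hxj⟩ := mem_iUnion₂.1 (hcov hxab)
      refine mem_iUnion₂.2 ⟨j, Finset.mem_erase.2 ⟨?_, hj⟩, hxj⟩
      rintro rfl
      exact (hcmax ⟨hxj, hxab⟩).not_gt hx.1
    have hsub' : Icc c b ⊆ ⋃ j ∈ I.erase i, C j := by
      rw [← closure_Ioc hlt.ne]
      exact hcl.closure_subset_iff.2 hsub
    have h2 := ih (I.erase i) hlt.le hsub' (by rw [Finset.card_erase_of_mem hi, hI]; rfl)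
    have h3 := norm_sub_le_norm_sub_add_norm_sub (f a) (f c) (f b)
    linarith

theorem norm_sub_le_of_finite_closed_cover {ι : Type*} {f : E → F} {K : ℝ} {S : ι → Set E}
    (hS : ∀ i, IsClosed (S i)) (hf : ∀ i, ∀ x ∈ S i, ∀ y ∈ S i, ‖f x - f y‖ ≤ K * ‖x - y‖)
    (I : Finset ι) {Ω : Set E} (hΩ : Convex ℝ Ω) (hcov : Ω ⊆ ⋃ i ∈ I, S i) {x y : E}
    (hx : x ∈ Ω) (hy : y ∈ Ω) : ‖f x - f y‖ ≤ K * ‖x - y‖ := by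
  have hline : Continuous (AffineMap.lineMap x y : ℝ → E) := AffineMap.lineMap_continuous
  have := norm_sub_le_of_finite_closed_cover_Icc (f := fun t => f (AffineMap.lineMap x y t))
    (K := K * ‖x - y‖) (C := fun i => (AffineMap.lineMap x y : ℝ → E) ⁻¹' S i)
    (fun i => (hS i).preimage hline) ?_ I zero_le_one ?_
  · simpa using this
  · intro i s hs t ht
    refine (hf i _ hs _ ht).trans_eq ?_
    rw [← dist_eq_norm, dist_lineMap_lineMap, ← dist_eq_norm, Real.dist_eq]
    ring
  · intro t ht
    have := hcov (hΩ.lineMap_mem hx hy ht)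
    simpa using this

end Gluing

/-! ### Simplicial partitions cover the domain -/

section Covering

variable {d : ℕ}

/-- A convex set with non-empty interior lies in the closure of its interior, so that an inclusion
almost everywhere into a closed set is an inclusion. -/
theorem Convex.subset_of_ae {E : Type*} [NormedAddCommGroup E] [NormedSpace ℝ E]
    [MeasurableSpace E] {μ : Measure E} [μ.IsOpenPosMeasure] {A B : Set E} (hA : Convex ℝ A)
    (hint : (interior A).Nonempty) (hB : IsClosed B) (h : ∀ᵐ x ∂μ, x ∈ A → x ∈ B) : A ⊆ B := by
  have hnull : μ (interior A ∩ Bᶜ) = 0 := by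
    refine measure_mono_null (fun x hx => ?_) h
    exact fun hAB => hx.2 (hAB (interior_subset hx.1))
  rw [(isOpen_interior.inter hB.isOpen_compl).measure_eq_zero_iff μ, ← sdiff_eq,
    sdiff_eq_empty] at hnull
  calc A ⊆ closure A := subset_closure
    _ = closure (interior A) := (hA.closure_interior_eq_closure_of_nonempty_interior hint).symm
    _ ⊆ B := hB.closure_subset_iff.2 hnull

theorem isClosed_convexHull_finset (s : Finset (EuclideanSpace ℝ (Fin d))) :
    IsClosed (convexHull ℝ (s : Set (EuclideanSpace ℝ (Fin d)))) :=
  s.finite_toSet.isClosed_convexHull ℝ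

variable {Ω : Set (EuclideanSpace ℝ (Fin d))} {𝔗 : Finset (Finset (EuclideanSpace ℝ (Fin d)))}

theorem NonexpansiveLearning.IsSimplicialPartition.convexHull_subset
    (h : IsSimplicialPartition Ω 𝔗) (hΩ : IsClosed Ω) {s : Finset (EuclideanSpace ℝ (Fin d))}
    (hs : s ∈ 𝔗) : convexHull ℝ (s : Set (EuclideanSpace ℝ (Fin d))) ⊆ Ω := by
  refine (convex_convexHull ℝ _).subset_of_ae (μ := volume) (h.interior_nonempty s hs) hΩ ?_
  filter_upwards [h.sum_indicator] with x hx hxs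
  by_contra hxΩ
  rw [indicator_of_notMem hxΩ, Finset.sum_eq_zero_iff_of_nonneg
    fun t _ => indicator_nonneg (fun _ _ => zero_le_one) x] at hx
  simpa [indicator_of_mem hxs] using hx s hs

theorem NonexpansiveLearning.IsSimplicialPartition.subset_iUnion_convexHull
    (h : IsSimplicialPartition Ω 𝔗) (hΩ : Convex ℝ Ω) (hint : (interior Ω).Nonempty) :
    Ω ⊆ ⋃ s ∈ 𝔗, convexHull ℝ (s : Set (EuclideanSpace ℝ (Fin d))) := by
  refine hΩ.subset_of_ae (μ := volume) hint
    (𝔗.finite_toSet.isClosed_biUnion fun s _ => isClosed_convexHull_finset s) ?_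
  filter_upwards [h.sum_indicator] with x hx hxΩ
  rw [indicator_of_mem hxΩ] at hx
  obtain ⟨s, hs, hne⟩ := Finset.exists_ne_zero_of_sum_ne_zero (hx.trans_ne one_ne_zero)
  exact mem_iUnion₂.2 ⟨s, hs, mem_of_indicator_ne_zero hne⟩

end Covering

/-! ### Edges of a non-degenerate simplex control linear maps -/

section Edges

variable {d : ℕ} {F : Type*} [NormedAddCommGroup F] [NormedSpace ℝ F]

/-- Cramer's rule with the Leibniz bound for the determinants in the numerators: `d` vectors in
the unit ball with determinant at least `c` represent every unit vector with coefficients of size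
at most `d! / c`. -/
theorem exists_eq_sum_smul_of_le_abs_det {w : Fin d → EuclideanSpace ℝ (Fin d)}
    (hw : ∀ j, ‖w j‖ ≤ 1) {c : ℝ} (hc : 0 < c)
    (hdet : c ≤ |(EuclideanSpace.basisFun (Fin d) ℝ).toBasis.det w|)
    {u : EuclideanSpace ℝ (Fin d)} (hu : ‖u‖ ≤ 1) :
    ∃ a : Fin d → ℝ, u = ∑ j, a j • w j ∧ ∀ j, |a j| ≤ d.factorial / c := by
  set A : Matrix (Fin d) (Fin d) ℝ := Matrix.of fun i j => w j i with hA
  have hdetA : (EuclideanSpace.basisFun (Fin d) ℝ).toBasis.det w = A.det := by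
    rw [Module.Basis.det_apply]
    congr 1
  rw [hdetA] at hdet
  have hA0 : A.det ≠ 0 := abs_pos.1 (hc.trans_le hdet)
  refine ⟨fun j => A.det⁻¹ * A.cramer u j, ?_, fun j => ?_⟩
  · ext i
    have h1 := congrFun (Matrix.mulVec_cramer A u) i
    simp only [Matrix.mulVec, dotProduct, Pi.smul_apply, smul_eq_mul, hA, Matrix.of_apply] at h1
    rw [← hA] at h1
    have h2 : u i = A.det⁻¹ * ∑ j, w j i * A.cramer u j := by
      rw [h1, inv_mul_cancel_left₀ hA0]
    simp only [WithLp.ofLp_sum, WithLp.ofLp_smul, Finset.sum_apply, Pi.smul_apply, smul_eq_mul]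
    rw [h2, Finset.mul_sum]
    exact Finset.sum_congr rfl fun j _ => by ring
  · beta_reduce
    rw [Matrix.cramer_apply, abs_mul, abs_inv, inv_mul_eq_div]
    have h1 : |(A.updateCol j u).det| ≤ d.factorial := by
      have := Matrix.det_le (A := A.updateCol j u) (abv := AbsoluteValue.abs) (x := 1)
        fun i l => by
          rw [Matrix.updateCol_apply]
          split_ifs
          · exact (PiLp.norm_apply_le u i).trans hu
          · exact (PiLp.norm_apply_le (w l) i).trans (hw l)
      simpa using this
    gcongr

/-- A simplex lies in a translate of the parallelepiped spanned by its edges at a vertex. -/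
theorem volume_convexHull_le_abs_det {s : Finset (EuclideanSpace ℝ (Fin d))}
    {v₀ : EuclideanSpace ℝ (Fin d)} {w : Fin d → EuclideanSpace ℝ (Fin d)}
    (hs : ∀ v ∈ s, v = v₀ ∨ ∃ j, v = v₀ + w j) :
    (volume : Measure (EuclideanSpace ℝ (Fin d))).real
        (convexHull ℝ (s : Set (EuclideanSpace ℝ (Fin d)))) ≤
      |(EuclideanSpace.basisFun (Fin d) ℝ).toBasis.det w| := by
  have hvol : volume (parallelepiped w) =
      ENNReal.ofReal |(EuclideanSpace.basisFun (Fin d) ℝ).toBasis.det w| := by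
    rw [← (EuclideanSpace.basisFun (Fin d) ℝ).addHaar_eq_volume]
    exact Measure.addHaar_parallelepiped _ _
  have hsub : convexHull ℝ (s : Set (EuclideanSpace ℝ (Fin d))) ⊆
      (fun x => v₀ + x) '' parallelepiped w := by
    refine convexHull_min (fun v hv => ?_) ?_
    · rcases hs v hv with rfl | ⟨j, rfl⟩
      · exact ⟨0, (mem_parallelepiped_iff _ _).2 ⟨0, by simp, by simp⟩, add_zero _⟩
      · refine ⟨w j, (mem_parallelepiped_iff _ _).2 ⟨Pi.single j 1, ⟨?_, ?_⟩, ?_⟩, rfl⟩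
        · simp [Pi.single_nonneg]
        · intro i
          by_cases h : i = j <;> simp [h]
        · simp [Pi.single_apply, ite_smul]
    · rw [parallelepiped_eq_convexHull]
      exact (convex_convexHull ℝ _).translate v₀
  rw [Measure.real]
  refine ENNReal.toReal_le_of_le_ofReal (abs_nonneg _) ?_
  rw [← hvol]
  refine (measure_mono hsub).trans_eq ?_
  rw [image_add_left, measure_preimage_add]

/-- In a simplex with edges of length at most `r` and volume at least `c r ^ d`, a linear map that
maps the edges at a vertex to vectors of size at most `ε r` has norm at most a multiple of `ε` that
depends only on `d` and `c`. -/
theorem norm_le_of_norm_apply_edge_le {s : Finset (EuclideanSpace ℝ (Fin d))}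
    (hcard : s.card = d + 1) {v₀ : EuclideanSpace ℝ (Fin d)} (hv₀ : v₀ ∈ s) {r c ε : ℝ}
    (hr : 0 < r) (hc : 0 < c) (hedge : ∀ v ∈ s, ‖v - v₀‖ ≤ r)
    (hvol : c * r ^ d ≤ (volume : Measure (EuclideanSpace ℝ (Fin d))).real
        (convexHull ℝ (s : Set (EuclideanSpace ℝ (Fin d)))))
    (A : EuclideanSpace ℝ (Fin d) →L[ℝ] F) (hε : 0 ≤ ε)
    (hA : ∀ v ∈ s, ‖A (v - v₀)‖ ≤ ε * r) :
    ‖A‖ ≤ d * (d.factorial / c) * ε := by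
  classical
  have hcard' : (s.erase v₀).card = d := by simp [Finset.card_erase_of_mem hv₀, hcard]
  let e : Fin d ≃ s.erase v₀ := (Finset.equivFinOfCardEq hcard').symm
  have he : ∀ j, (e j : EuclideanSpace ℝ (Fin d)) ∈ s := fun j => Finset.mem_of_mem_erase (e j).2
  have hdet := volume_convexHull_le_abs_det (s := s) (v₀ := v₀)
    (w := fun j => (e j : EuclideanSpace ℝ (Fin d)) - v₀) fun v hv => by
      by_cases h : v = v₀
      · exact Or.inl h
      · refine Or.inr ⟨e.symm ⟨v, Finset.mem_erase.2 ⟨h, hv⟩⟩, ?_⟩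
        simp
  have hscale : (fun j => (e j : EuclideanSpace ℝ (Fin d)) - v₀) =
      fun j => r • (r⁻¹ • ((e j : EuclideanSpace ℝ (Fin d)) - v₀)) := by
    ext1 j
    rw [smul_inv_smul₀ hr.ne']
  rw [hscale, AlternatingMap.map_smul_univ (c := fun _ : Fin d => r)] at hdet
  simp only [Finset.prod_const, Finset.card_univ, Fintype.card_fin, smul_eq_mul, abs_mul,
    abs_pow, abs_of_pos hr] at hdet
  have hdet' := le_of_mul_le_mul_right ((hvol.trans hdet).trans_eq (mul_comm _ _)) (pow_pos hr d)
  refine ContinuousLinearMap.opNorm_le_of_unit_norm (by positivity) fun u hu => ?_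
  have hw : ∀ j, ‖r⁻¹ • ((e j : EuclideanSpace ℝ (Fin d)) - v₀)‖ ≤ 1 := fun j => by
    rw [norm_smul, norm_inv, Real.norm_eq_abs, abs_of_pos hr, inv_mul_le_iff₀ hr, mul_one]
    exact hedge _ (he j)
  obtain ⟨a, hau, ha⟩ := exists_eq_sum_smul_of_le_abs_det hw hc hdet' hu.le
  rw [hau, map_sum]
  have hterm : ∀ j ∈ Finset.univ, ‖A (a j • r⁻¹ • ((e j : EuclideanSpace ℝ (Fin d)) - v₀))‖
      ≤ d.factorial / c * ε := by
    intro j _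
    rw [map_smul, map_smul, norm_smul, norm_smul, Real.norm_eq_abs, norm_inv, Real.norm_eq_abs,
      abs_of_pos hr]
    have : r⁻¹ * ‖A ((e j : EuclideanSpace ℝ (Fin d)) - v₀)‖ ≤ ε := by
      rw [inv_mul_le_iff₀ hr, mul_comm r]
      exact hA _ (he j)
    exact mul_le_mul (ha j) this (by positivity) (by positivity)
  refine (norm_sum_le_of_le _ hterm).trans_eq ?_
  simp [mul_assoc]

end Edges

/-! ### Smoothing of nonexpansive maps -/

section Mollification

open scoped Convolution

variable {E F : Type*} [NormedAddCommGroup E] [InnerProductSpace ℝ E] [FiniteDimensional ℝ E]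
  [NormedAddCommGroup F] [NormedSpace ℝ F] [CompleteSpace F]

/-- Convolution with a normalized bump function keeps a map nonexpansive. -/
theorem exists_contDiff_nonexpansive_norm_sub_le {f : E → F}
    (hf : ∀ x y, ‖f x - f y‖ ≤ ‖x - y‖) {δ : ℝ} (hδ : 0 < δ) :
    ∃ g : E → F, ContDiff ℝ 1 g ∧ (∀ x y, ‖g x - g y‖ ≤ ‖x - y‖) ∧
      ∀ x, ‖g x - f x‖ ≤ δ := by
  borelize E
  let μ : Measure E := volume
  have hcont : Continuous f := by
    refine LipschitzWith.continuous (K := 1) (LipschitzWith.of_dist_le_mul fun x y => ?_)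
    simpa [dist_eq_norm] using hf x y
  let φ : ContDiffBump (0 : E) := ⟨δ / 2, δ, by positivity, by linarith⟩
  refine ⟨φ.normed μ ⋆[ContinuousLinearMap.lsmul ℝ ℝ, μ] f, ?_, fun x y => ?_, fun x => ?_⟩
  · exact φ.hasCompactSupport_normed.contDiff_convolution_left _ φ.contDiff_normed
      hcont.locallyIntegrable
  · have hint : ∀ z, Integrable (fun t => φ.normed μ t • f (z - t)) μ := fun z =>
      (φ.hasCompactSupport_normed.convolutionExists_left (ContinuousLinearMap.lsmul ℝ ℝ)
        φ.continuous_normed hcont.locallyIntegrable z).integrable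
    simp only [convolution_lsmul]
    rw [← integral_sub (hint x) (hint y)]
    calc ‖∫ t, (φ.normed μ t • f (x - t) - φ.normed μ t • f (y - t)) ∂μ‖
        ≤ ∫ t, φ.normed μ t * ‖x - y‖ ∂μ := by
          refine norm_integral_le_of_norm_le (φ.integrable_normed.mul_const _)
            (Eventually.of_forall fun t => ?_)
          rw [← smul_sub, norm_smul, Real.norm_of_nonneg (φ.nonneg_normed t)]
          refine mul_le_mul_of_nonneg_left ?_ (φ.nonneg_normed t)
          simpa using hf (x - t) (y - t)
      _ = ‖x - y‖ := by rw [integral_mul_const, φ.integral_normed, one_mul]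
  · rw [← dist_eq_norm]
    refine φ.dist_normed_convolution_le hcont.aestronglyMeasurable fun y hy => ?_
    refine le_trans ?_ (Metric.mem_ball.1 hy).le
    simpa only [dist_eq_norm] using hf y x

end Mollification

/-! ### Piecewise affine interpolation of smooth contractions -/

section Interpolation

variable {d : ℕ}

/-- On each simplex, a piecewise affine function is the affine interpolant of its values at the
vertices. -/
theorem NonexpansiveLearning.IsLagrangeBasis.exists_affine_eqOn
    {𝔗 : Finset (Finset (EuclideanSpace ℝ (Fin d)))}
    {lam : EuclideanSpace ℝ (Fin d) → EuclideanSpace ℝ (Fin d) → ℝ} (hlam : IsLagrangeBasis 𝔗 lam)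
    (y : EuclideanSpace ℝ (Fin d) → EuclideanSpace ℝ (Fin d))
    {s : Finset (EuclideanSpace ℝ (Fin d))} (hs : s ∈ 𝔗) :
    ∃ G : EuclideanSpace ℝ (Fin d) →ᵃ[ℝ] EuclideanSpace ℝ (Fin d),
      EqOn (fun x => ∑ v ∈ vertices 𝔗, lam v x • y v) G
        (convexHull ℝ (s : Set (EuclideanSpace ℝ (Fin d)))) := by
  choose! g hg using fun v hv => hlam.2 v hv s hs
  refine ⟨∑ v ∈ vertices 𝔗, (LinearMap.toSpanSingleton ℝ _ (y v)).toAffineMap.comp (g v),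
    fun x hx => ?_⟩
  have hsum : ∀ I : Finset (EuclideanSpace ℝ (Fin d)),
      (∑ v ∈ I, (LinearMap.toSpanSingleton ℝ _ (y v)).toAffineMap.comp (g v)) x
        = ∑ v ∈ I, g v x • y v := by
    classical
    intro I
    induction I using Finset.induction_on with
    | empty => simp
    | insert v I hv ih => simp [Finset.sum_insert hv, ih]
  rw [hsum]
  exact Finset.sum_congr rfl fun v hv => by rw [hg v hv hx]

theorem NonexpansiveLearning.IsLagrangeBasis.sum_smul_apply_vertex
    {𝔗 : Finset (Finset (EuclideanSpace ℝ (Fin d)))}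
    {lam : EuclideanSpace ℝ (Fin d) → EuclideanSpace ℝ (Fin d) → ℝ} (hlam : IsLagrangeBasis 𝔗 lam)
    (y : EuclideanSpace ℝ (Fin d) → EuclideanSpace ℝ (Fin d))
    {w : EuclideanSpace ℝ (Fin d)} (hw : w ∈ vertices 𝔗) :
    ∑ v ∈ vertices 𝔗, lam v w • y v = y w := by
  rw [Finset.sum_eq_single_of_mem w hw fun v hv hvw => by simp [hlam.1 v hv w hw, hvw],
    hlam.1 w hw w hw, if_pos rfl, one_smul]

theorem mem_vertices {𝔗 : Finset (Finset (EuclideanSpace ℝ (Fin d)))}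
    {v : EuclideanSpace ℝ (Fin d)} : v ∈ vertices 𝔗 ↔ ∃ s ∈ 𝔗, v ∈ s := by
  simp [vertices]

/-- On fine, strongly regular simplices, affine interpolants of a `C¹` map that is
`q`-Lipschitz with `q < 1` are nonexpansive: by the mean value inequality the linear part of the
interpolant differs on the edges from the derivative at a vertex by the oscillation of the
derivative times the mesh size. -/
theorem eventually_nonexpansive_interpolant {Ω : Set (EuclideanSpace ℝ (Fin d))}
    (hΩ : IsCompact Ω) {𝔉 : ℕ+ → Finset (Finset (EuclideanSpace ℝ (Fin d)))}
    (hvan : IsVanishingFamily Ω 𝔉) (hreg : IsStronglyRegular 𝔉)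
    {g : EuclideanSpace ℝ (Fin d) → EuclideanSpace ℝ (Fin d)} (hg : ContDiff ℝ 1 g) {q : ℝ}
    (hq0 : 0 ≤ q) (hq1 : q < 1) (hgq : ∀ x y, ‖g x - g y‖ ≤ q * ‖x - y‖) :
    ∃ K : ℕ+, ∀ k ≥ K, ∀ s ∈ 𝔉 k,
      ∀ G : EuclideanSpace ℝ (Fin d) →ᵃ[ℝ] EuclideanSpace ℝ (Fin d), (∀ v ∈ s, G v = g v) →
        ∀ x y, ‖G x - G y‖ ≤ ‖x - y‖ := by
  obtain ⟨c, hc, hvol⟩ := hreg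
  set B : ℝ := d * (d.factorial / c) with hB
  have hB0 : 0 ≤ B := by positivity
  -- the oscillation of the derivative that the gap `1 - q` leaves room for
  set ε : ℝ := (1 - q) / (B + 1) with hε
  have hε0 : 0 < ε := div_pos (by linarith) (by linarith)
  have hBε : B * ε ≤ 1 - q := by
    rw [hε, mul_div_assoc', div_le_iff₀ (by linarith)]
    nlinarith
  have huc := hΩ.uniformContinuousOn_of_continuous (hg.continuous_fderiv one_ne_zero).continuousOn
  obtain ⟨δ, hδ, hosc⟩ := Metric.uniformContinuousOn_iff.1 huc ε hε0
  obtain ⟨m, hm⟩ := exists_nat_one_div_lt hδ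
  refine ⟨m.succPNat, fun k hk s hs G hG => ?_⟩
  have hk0 : (0 : ℝ) < k := by exact_mod_cast k.pos
  have hkδ : 1 / (k : ℝ) < δ := by
    refine lt_of_le_of_lt (one_div_le_one_div_of_le (by positivity) ?_) hm
    exact_mod_cast (PNat.coe_le_coe _ _).2 hk
  have hpart := hvan.1 k
  have hsΩ := hpart.convexHull_subset hΩ.isClosed hs
  have hcard := hpart.card_eq s hs
  obtain ⟨v₀, hv₀⟩ : s.Nonempty := Finset.card_pos.1 (by omega)
  have hedge : ∀ v ∈ s, ‖v - v₀‖ ≤ 1 / (k : ℝ) := fun v hv => by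
    rw [← dist_eq_norm]
    exact hvan.2 k s hs v hv v₀ hv₀
  have hball : convexHull ℝ (s : Set (EuclideanSpace ℝ (Fin d))) ⊆
      Metric.closedBall v₀ (1 / (k : ℝ)) :=
    convexHull_min (fun v hv => by
      rw [Metric.mem_closedBall, dist_eq_norm]
      exact hedge v hv) (convex_closedBall _ _)
  have hmem : ∀ v ∈ s, v ∈ convexHull ℝ (s : Set (EuclideanSpace ℝ (Fin d))) := fun v hv =>
    subset_convexHull ℝ _ hv
  have hmv : ∀ v ∈ s, ‖g v - g v₀ - fderiv ℝ g v₀ (v - v₀)‖ ≤ ε * ‖v - v₀‖ := fun v hv =>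
    (convex_convexHull ℝ _).norm_image_sub_le_of_norm_fderiv_le'
      (fun x _ => (hg.differentiable one_ne_zero).differentiableAt)
      (fun x hx => by
        rw [← dist_eq_norm]
        exact (hosc x (hsΩ hx) v₀ (hsΩ (hmem v₀ hv₀))
          ((Metric.mem_closedBall.1 (hball hx)).trans_lt hkδ)).le)
      (hmem v₀ hv₀) (hmem v hv)
  have hlin : ∀ x y, G.linear (x - y) = G x - G y := fun x y => by
    simpa using G.linearMap_vsub x y
  set A : EuclideanSpace ℝ (Fin d) →L[ℝ] EuclideanSpace ℝ (Fin d) :=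
    LinearMap.toContinuousLinearMap G.linear with hA
  have hAG : ∀ x y, A (x - y) = G x - G y := hlin
  have hdiff : ‖A - fderiv ℝ g v₀‖ ≤ B * ε := by
    refine norm_le_of_norm_apply_edge_le hcard hv₀ (one_div_pos.2 hk0) hc hedge ?_ _ hε0.le
      fun v hv => ?_
    · refine le_trans (le_of_eq ?_) (hvol k s hs)
      rw [one_div, inv_pow, div_eq_mul_inv]
    · rw [sub_apply, hAG, hG v hv, hG v₀ hv₀]
      exact (hmv v hv).trans (by gcongr; exact hedge v hv)
  have hder : ‖fderiv ℝ g v₀‖ ≤ q := by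
    refine norm_fderiv_le_of_lipschitz ℝ (C := ⟨q, hq0⟩) (LipschitzWith.of_dist_le_mul
      fun x y => ?_)
    rw [dist_eq_norm, dist_eq_norm]
    exact hgq x y
  intro x y
  rw [← hAG]
  refine (A.le_of_opNorm_le (c := 1) ?_ _).trans_eq (one_mul _)
  have := norm_add_le (A - fderiv ℝ g v₀) (fderiv ℝ g v₀)
  rw [sub_add_cancel] at this
  linarith

/-- For fine partitions, the piecewise affine interpolant of a `C¹` map that is `q`-Lipschitz with
`q < 1` is an admissible piecewise affine nonexpansive operator. -/
theorem eventually_exists_mem_piecewiseAffineOps {Ω : Set (EuclideanSpace ℝ (Fin d))}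
    (hΩ : IsCompact Ω) (hconv : Convex ℝ Ω) (hint : (interior Ω).Nonempty)
    {𝔉 : ℕ+ → Finset (Finset (EuclideanSpace ℝ (Fin d)))}
    (hvan : IsVanishingFamily Ω 𝔉) (hreg : IsStronglyRegular 𝔉)
    (hlam : ∀ k, ∃ lam, IsLagrangeBasis (𝔉 k) lam)
    {g : EuclideanSpace ℝ (Fin d) → EuclideanSpace ℝ (Fin d)} (hg : ContDiff ℝ 1 g) {q : ℝ}
    (hq0 : 0 ≤ q) (hq1 : q < 1) (hgq : ∀ x y, ‖g x - g y‖ ≤ q * ‖x - y‖) :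
    ∃ K : ℕ+, ∀ k ≥ K, ∃ N ∈ piecewiseAffineOps Ω (𝔉 k) ∩ nonexpansiveOps _,
      ∀ v ∈ vertices (𝔉 k), N v = g v := by
  obtain ⟨K, hK⟩ := eventually_nonexpansive_interpolant hΩ hvan hreg hg hq0 hq1 hgq
  refine ⟨K, fun k hk => ?_⟩
  obtain ⟨lam, hlamk⟩ := hlam k
  have hpart := hvan.1 k
  have hne : Ω.Nonempty := hint.mono interior_subset
  set P : EuclideanSpace ℝ (Fin d) → EuclideanSpace ℝ (Fin d) :=
    fun x => ∑ v ∈ vertices (𝔉 k), lam v x • g v with hP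
  have hPv : ∀ v ∈ vertices (𝔉 k), P v = g v := fun v hv => hlamk.sum_smul_apply_vertex g hv
  have hPs : ∀ s : 𝔉 k, ∀ x ∈ convexHull ℝ (s.1 : Set (EuclideanSpace ℝ (Fin d))),
      ∀ y ∈ convexHull ℝ (s.1 : Set (EuclideanSpace ℝ (Fin d))), ‖P x - P y‖ ≤ 1 * ‖x - y‖ := by
    intro s x hx y hy
    obtain ⟨G, hG⟩ := hlamk.exists_affine_eqOn g s.2
    rw [one_mul, show P x = G x from hG hx, show P y = G y from hG hy]
    refine hK k hk s.1 s.2 G (fun v hv => ?_) x y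
    rw [← hPv v (mem_vertices.2 ⟨s.1, s.2, hv⟩)]
    exact (hG (subset_convexHull ℝ _ hv)).symm
  have hPΩ : ∀ x ∈ Ω, ∀ y ∈ Ω, ‖P x - P y‖ ≤ ‖x - y‖ := by
    intro x hx y hy
    have hcov : Ω ⊆ ⋃ s ∈ (Finset.univ : Finset (𝔉 k)),
        convexHull ℝ (s.1 : Set (EuclideanSpace ℝ (Fin d))) := by
      simpa [iUnion_subtype] using hpart.subset_iUnion_convexHull hconv hint
    simpa using norm_sub_le_of_finite_closed_cover
      (fun s : 𝔉 k => isClosed_convexHull_finset s.1) hPs Finset.univ hconv hcov hx hy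
  have hproj : ∀ x, proj Ω x ∈ Ω := fun x => (proj_spec hΩ.isClosed hne x).1
  have hN : ∀ x y, ‖P (proj Ω x) - P (proj Ω y)‖ ≤ ‖x - y‖ := fun x y =>
    (hPΩ _ (hproj x) _ (hproj y)).trans (norm_proj_sub_proj_le hΩ.isClosed hne hconv x y)
  refine ⟨⟨fun x => P (proj Ω x), 1, LipschitzWith.of_dist_le_mul fun x y => ?_⟩,
    ⟨⟨lam, hlamk, g, fun x => rfl⟩, hN⟩, fun v hv => ?_⟩
  · simpa [dist_eq_norm] using hN x y
  · obtain ⟨s, hs, hvs⟩ := mem_vertices.1 hv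
    have hvΩ : v ∈ Ω := hpart.convexHull_subset hΩ.isClosed hs (subset_convexHull ℝ _ hvs)
    change P (proj Ω v) = g v
    rw [proj_eq_self hΩ.isClosed hvΩ, hPv v hv]

end Interpolation

/-! ### Smooth contractions recover the infimum of the risk -/

section Limit

/-- Every nonexpansive operator is a pointwise limit of `C¹` strict contractions: shrink
mollifications by factors tending to `1`. -/
theorem exists_seq_contDiff_contraction_tendsto {E : Type*} [NormedAddCommGroup E]
    [InnerProductSpace ℝ E] [FiniteDimensional ℝ E] {N : LipOp E} (hN : N ∈ nonexpansiveOps E) :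
    ∃ M : ℕ → LipOp E, (∀ m, ContDiff ℝ 1 (M m)) ∧
      (∀ m, ∃ q, 0 ≤ q ∧ q < 1 ∧ ∀ x y, ‖M m x - M m y‖ ≤ q * ‖x - y‖) ∧
      ∀ x, Tendsto (fun m => M m x) atTop (𝓝 (N x)) := by
  have hδ : ∀ m : ℕ, (0 : ℝ) < 1 / ((m : ℝ) + 1) := fun m => by positivity
  choose g hgc hgne hgN using fun m : ℕ => exists_contDiff_nonexpansive_norm_sub_le hN (hδ m)
  set q : ℕ → ℝ := fun m => 1 - 1 / ((m : ℝ) + 1) with hq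
  have hq0 : ∀ m, 0 ≤ q m := fun m => by
    rw [hq, sub_nonneg, div_le_one (by positivity)]
    linarith [(Nat.cast_nonneg m : (0 : ℝ) ≤ m)]
  have hq1 : ∀ m, q m < 1 := fun m => by
    have := hδ m
    simp only [hq]
    linarith
  have hM : ∀ m x y, ‖q m • g m x - q m • g m y‖ ≤ q m * ‖x - y‖ := fun m x y => by
    rw [← smul_sub, norm_smul, Real.norm_of_nonneg (hq0 m)]
    exact mul_le_mul_of_nonneg_left (hgne m x y) (hq0 m)
  have hlim := tendsto_one_div_add_atTop_nhds_zero_nat (𝕜 := ℝ)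
  refine ⟨fun m => ⟨fun x => q m • g m x, ⟨q m, hq0 m⟩, LipschitzWith.of_dist_le_mul fun x y => ?_⟩,
    fun m => (hgc m).const_smul (q m), fun m => ⟨q m, hq0 m, hq1 m, hM m⟩, fun x => ?_⟩
  · rw [dist_eq_norm, dist_eq_norm]
    exact hM m x y
  · have h1 : Tendsto (fun m => g m x) atTop (𝓝 (N x)) :=
      tendsto_iff_norm_sub_tendsto_zero.2
        (squeeze_zero (fun _ => norm_nonneg _) (fun m => hgN m x) hlim)
    have h2 : Tendsto q atTop (𝓝 1) := by simpa [hq] using hlim.const_sub 1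
    simpa using h2.smul h1

theorem norm_apply_le_of_discreteRisk_le {E : Type*} [NormedAddCommGroup E]
    [InnerProductSpace ℝ E] {n : ℕ} (xbar ybar : Fin n → E) {C : ℝ} {N : LipOp E}
    (hN : N ∈ nonexpansiveOps E) (hC : discreteRisk xbar ybar N ≤ C) (i : Fin n) (x : E) :
    ‖N x‖ ≤ Real.sqrt (n * C) + ‖ybar i‖ + ‖x - xbar i‖ := by
  have hn : (0 : ℝ) < n := by exact_mod_cast i.pos
  have h1 : ‖N (xbar i) - ybar i‖ ≤ Real.sqrt (n * C) := by
    refine Real.le_sqrt_of_sq_le ?_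
    rw [discreteRisk, one_div, inv_mul_le_iff₀ hn] at hC
    exact (Finset.single_le_sum (f := fun i => ‖N (xbar i) - ybar i‖ ^ 2)
      (fun j _ => by positivity) (Finset.mem_univ i)).trans hC
  have h2 := norm_add₃_le (a := N x - N (xbar i)) (b := N (xbar i) - ybar i) (c := ybar i)
  rw [sub_add_sub_cancel, sub_add_cancel] at h2
  linarith [hN x (xbar i)]

end Limit

theorem theorem3p11 {d : ℕ}
    (D : Finset (EuclideanSpace ℝ (Fin d)))
    (hD : affineSpan ℝ (D : Set (EuclideanSpace ℝ (Fin d))) = ⊤)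
    {n : ℕ} (hn : 0 < n) (xbar ybar : Fin n → EuclideanSpace ℝ (Fin d))
    (𝔉 : ℕ+ → Finset (Finset (EuclideanSpace ℝ (Fin d))))
    (hvanishing : IsVanishingFamily (convexHull ℝ (D : Set (EuclideanSpace ℝ (Fin d)))) 𝔉)
    (hregular : IsStronglyRegular 𝔉)
    (hxbar : ∀ k i, xbar i ∈ vertices (𝔉 k))
    (L : ℕ+ → LipOp (EuclideanSpace ℝ (Fin d)))
    (hL : ∀ k, L k ∈ argminOn (discreteRisk xbar ybar)
      (piecewiseAffineOps (convexHull ℝ (D : Set (EuclideanSpace ℝ (Fin d)))) (𝔉 k) ∩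
        nonexpansiveOps (EuclideanSpace ℝ (Fin d)))) :
    ∃ φ : ℕ → ℕ+, StrictMono φ ∧
      ∃ Lhat ∈ argminOn (discreteRisk xbar ybar) (nonexpansiveOps (EuclideanSpace ℝ (Fin d))),
        WeakStarTendsto (fun j => L (φ j)) Lhat := by
  have hΩ : IsCompact (convexHull ℝ (D : Set (EuclideanSpace ℝ (Fin d)))) :=
    D.finite_toSet.isCompact_convexHull ℝ
  have hint := interior_convexHull_nonempty_iff_affineSpan_eq_top.2 hD
  -- Lagrange elements exist since the set of piecewise affine operators contains `L k`.
  have hlam : ∀ k, ∃ lam, IsLagrangeBasis (𝔉 k) lam := fun k => by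
    obtain ⟨lam, hlam, -⟩ := (hL k).1.1
    exact ⟨lam, hlam⟩
  have hLne : ∀ k, L k ∈ nonexpansiveOps (EuclideanSpace ℝ (Fin d)) := fun k => (hL k).1.2
  have hzero : ∀ k, discreteRisk xbar ybar (L k) ≤ discreteRisk xbar ybar 0 := fun k => by
    obtain ⟨lam, hlam⟩ := hlam k
    refine (hL k).2 0 ⟨⟨lam, hlam, 0, fun x => ?_⟩, fun x y => ?_⟩
    · simp [lipOp_zero_apply]
    · simp [lipOp_zero_apply]
  obtain ⟨ψ, hψ, Lhat, hLhat, hpt, hweak⟩ := exists_subseq_weakStarTendsto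
    (T := fun j : ℕ => L j.succPNat) (fun j => hLne _)
    (fun j x => norm_apply_le_of_discreteRisk_le xbar ybar (hLne _) (hzero _) ⟨0, hn⟩ x)
  refine ⟨fun j => (ψ j).succPNat, fun i j hij => Nat.succPNat_lt_succPNat.2 (hψ hij), Lhat,
    ⟨hLhat, fun N hN => ?_⟩, hweak⟩
  obtain ⟨M, hMc, hMq, hMN⟩ := exists_seq_contDiff_contraction_tendsto hN
  refine ge_of_tendsto' (tendsto_discreteRisk xbar ybar hMN) fun m => ?_
  obtain ⟨q, hq0, hq1, hq⟩ := hMq m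
  obtain ⟨K, hK⟩ := eventually_exists_mem_piecewiseAffineOps hΩ (convex_convexHull ℝ _) hint
    hvanishing hregular hlam (hMc m) hq0 hq1 hq
  refine le_of_tendsto (tendsto_discreteRisk xbar ybar hpt) ?_
  filter_upwards [eventually_ge_atTop (K : ℕ)] with j hj
  obtain ⟨P, hP, hPv⟩ := hK (ψ j).succPNat
    ((PNat.coe_le_coe _ _).1 (hj.trans ((hψ.id_le j).trans (Nat.le_succ _))))
  -- the interpolant has the risk of `M m`, because the sample points are vertices
  have hrisk : discreteRisk xbar ybar P = discreteRisk xbar ybar (M m) := by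
    simp only [discreteRisk, hPv _ (hxbar _ _)]
  exact ((hL _).2 P hP).trans_eq hrisk
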